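/- \textbf{Theorem (Rademacher complexity of a one-layer Transformer without positional encoding, in-context linear regression).} \emph{Data.} A context of length $t$ is $S_t=((x_i,y_i))_{i\le t}$, where $\mu\sim\mathcal N(0,I_d/d)$, independently $x_1,\dots,x_t\overset{iid}{\sim}\mathcal N(0,I_d)$, and $y_i=\mu^\top x_i$. Let $X_t\in\mathbb R^{t\times d}$ be the matrix with rows $x_i^\top$, $G_t=\frac1t X_t^\top X_t$, and $\hat w=(X_t^\top X_t)^{-1}X_t^\top y$ the OLS solution. \emph{Model.} A prompt (a context and a query $x_q$) is the matrix $X\in\mathbb R^{(t+1)\times(d+1)}$ with rows $(x_i^\top,y_i)$, $i\le t$, and last row $(x_q^\top,0)$. For $\theta=(W_{\rm in},W_{QK})\in\mathbb R^{(d+1)\times d_m}\times\mathbb R^{d_m\times d_m}$, fixed $W_V\in\mathbb R^{d_m\times d_m}$, $W_c\in\mathbb R^{d_m}$ and a Lipschitz activation $\sigma:\mathbb R\to\mathbb R$ (applied entrywise), put $H=XW_{\rm in}$ and let $f_\theta(X)=W_c^\top h'_q$, where $h'_q$ is the last row of $\sigma\big(\mathrm{RowSoftmax}(HW_{QK}H^\top/\sqrt{d_m})\,HW_V\big)$.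 Write $\|\theta_1-\theta_2\|_2$ for the Euclidean distance of parameter pairs, and $D=d\,d_m+d_m^2$. \emph{Ideal attention matrices.} $W^*_{QK}(S_t)=\Psi(G_t)$ and $W^*_{QK}=\Psi(I_d)$, where $\Psi:\mathbb R^{d\times d}\to\mathbb R^{d_m\times d_m}$ is measurable and Lipschitz near $I_d$ (from the spectral to the Frobenius norm). Put $\Delta_t=\|\Psi(G_t)-\Psi(I_d)\|_F$. For a set $\Theta$ of parameters, $\gamma>0$ and $\gamma_{\rm eff}\ge\gamma+\Delta_t$, let $$\Theta_{S_t}=\{(W_{\rm in},W_{QK})\in\Theta:\ \|W_{QK}-W^*_{QK}(S_t)\|_F\le\gamma_{\rm eff}\},\qquad \mathcal F_{S_t}=\{f_\theta:\theta\in\Theta_{S_t}\}.$$ \emph{Effective weights.} For $\theta\in\Theta_{S_t}$ let $G(\theta)=\arg\min_{w\in\mathbb R^d}\mathbb E_{x_q\sim\mathcal N(0,I_d)}\big(f_\theta(S_t,x_q)-w^\top x_q\big)^2$. \emph{Rademacher complexity.} For a sample $S=(Z_1,\dots,Z_m)$ of $m\ge1$ prompts with contexts of length $t$, $\|f\|_{m,2}^2=\frac1m\sum_i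 f(Z_i)^2$ and $\operatorname{Rad}_S(\mathcal F)=\frac1m\mathbb E_\epsilon\sup_{f\in\mathcal F}\sum_i\epsilon_i f(Z_i)$ with independent uniform signs $\epsilon_i$. \emph{Claim.} Let $d\ge1$ and $\delta\in(0,1)$. There is a constant $C>0$ depending only on $d$ and $\delta$, and for all $d_m\ge1$ and $\Psi$ as above a constant $\Delta^*\ge0$ not depending on $t$, such that for every $t>d$, with probability at least $1-\delta$ over $S_t$: (a) $\Delta_t\le\Delta^*$ (so that $\gamma_{\rm eff}=\gamma+\Delta^*$ is admissible above), and every $\theta\in\Theta$ with $\|W_{QK}-W^*_{QK}\|_F\le\gamma$ belongs to $\Theta_{S_t}$; (b) simultaneously for all $\sigma,W_V,W_c,\Theta,\gamma,\gamma_{\rm eff}$ as above, all $L_G>0$, $r\in(0,t/2]$, $L_f\ge0$ and all samples $S$ of any size $m\ge1$: if (i) ($G$ is inverse Lipschitz) $\|\theta_1-\theta_2\|_2\le L_G\|G(\theta_1)-G(\theta_2)\|_2$ for all $\theta_1,\theta_2\in\Theta_{S_t}$, (ii) (tolerance $r$) $(w-\hat w)^\top X_t^\top X_t(w-\hat w)\le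 r$ for all $w\in W_{S_t}:=G(\Theta_{S_t})$, and (iii) ($\theta\mapsto f_\theta$ is Lipschitz) $\|f_{\theta_1}-f_{\theta_2}\|_{m,2}\le L_f\|\theta_1-\theta_2\|_2$ for all $\theta_1,\theta_2\in\Theta_{S_t}$, then the suprema in $\operatorname{Rad}_S(\mathcal F_{S_t})$ are finite and $$\operatorname{Rad}_S(\mathcal F_{S_t})\ \le\ C\,L_G\,\frac{L_f\sqrt{rD}\,\sqrt{\log(t/r)}}{\sqrt{mt}} .$$ -/

import Mathlib

open MeasureTheory ProbabilityTheory
open scoped Matrix Topology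

namespace ICL

/-- Input space `ℝᵈ` with the Euclidean norm. -/
abbrev Vec (d : ℕ) : Type := EuclideanSpace ℝ (Fin d)

/-- A context `S_t = ((x₁, y₁), …, (x_t, y_t))`. -/
abbrev Context (d t : ℕ) : Type := Fin t → Vec d × ℝ

/-- A prompt: a context together with a query. -/
abbrev Prompt (d t : ℕ) : Type := Context d t × Vec d

/-- The parameter pair `θ = (W_in, W_QK)`. -/
abbrev Param (d dm : ℕ) : Type := Matrix (Fin (d + 1)) (Fin dm) ℝ × Matrix (Fin dm) (Fin dm) ℝ

noncomputable section

/-- Law of a context under the noiseless linear model: `μ ∼ N(0, I_d / d)`, independent of the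
i.i.d. inputs `x_i ∼ N(0, I_d)`, and `y_i = ⟨μ, x_i⟩`. -/
def contextLaw (d t : ℕ) : Measure (Context d t) :=
  ((multivariateGaussian (0 : Vec d) ((d : ℝ)⁻¹ • (1 : Matrix (Fin d) (Fin d) ℝ))).prod
      (Measure.pi fun _ : Fin t => stdGaussian (Vec d))).map
    fun p i => (p.2 i, inner ℝ p.1 (p.2 i))

/-! ### The Transformer -/

/-- The `(t+1) × (d+1)` input matrix with rows `(x_i, y_i)` and last row `(x_q, 0)`. -/
def promptMatrix {d t : ℕ} (P : Prompt d t) : Matrix (Fin (t + 1)) (Fin (d + 1)) ℝ :=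
  Matrix.of fun i =>
    Fin.snoc (α := fun _ => Fin (d + 1) → ℝ)
      (fun j : Fin t => Fin.snoc (α := fun _ => ℝ) (fun k => (P.1 j).1 k) (P.1 j).2)
      (Fin.snoc (α := fun _ => ℝ) (fun k => P.2 k) 0) i

/-- Softmax applied to every row. -/
def rowSoftmax {n k : ℕ} (M : Matrix (Fin n) (Fin k) ℝ) : Matrix (Fin n) (Fin k) ℝ :=
  Matrix.of fun i j => Real.exp (M i j) / ∑ l, Real.exp (M i l)

/-- One-layer, single-head Transformer without positional encoding, read out at the query row:
`H = X W_in`, `H' = act (RowSoftmax (H W_QK Hᵀ / √d_m) H W_V)`, prediction `W_cᵀ h'_q`. -/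
def transformer {d dm t : ℕ} (act : ℝ → ℝ) (WV : Matrix (Fin dm) (Fin dm) ℝ) (Wc : Fin dm → ℝ)
    (θ : Param d dm) (P : Prompt d t) : ℝ :=
  let H := promptMatrix P * θ.1
  let H' := (rowSoftmax ((√(dm : ℝ))⁻¹ • (H * θ.2 * Hᵀ)) * H * WV).map act
  Wc ⬝ᵥ H' (Fin.last t)

/-! ### Norms and Rademacher complexity -/

/-- Frobenius norm. -/
def frobNorm {n k : ℕ} (A : Matrix (Fin n) (Fin k) ℝ) : ℝ := √(∑ i, ∑ j, A i j ^ 2)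

/-- Spectral norm. -/
def specNorm {n : ℕ} (A : Matrix (Fin n) (Fin n) ℝ) : ℝ := ‖Matrix.toEuclideanCLM (𝕜 := ℝ) A‖

/-- Euclidean distance of parameter pairs. -/
def paramDist {d dm : ℕ} (θ₁ θ₂ : Param d dm) : ℝ :=
  √(frobNorm (θ₁.1 - θ₂.1) ^ 2 + frobNorm (θ₁.2 - θ₂.2) ^ 2)

/-- The empirical 2-norm on a sample. -/
def empNorm {X : Type*} {m : ℕ} (S : Fin m → X) (f : X → ℝ) : ℝ :=
  √((∑ i, f (S i) ^ 2) / m)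

/-- The signed sums `∑ σ_i f(z_i)`, `f ∈ F`, for a sign pattern `σ` (`true` is `+1`). -/
def signedSums {X : Type*} {m : ℕ} (S : Fin m → X) (F : Set (X → ℝ)) (s : Fin m → Bool) : Set ℝ :=
  (fun f : X → ℝ => ∑ i, (if s i then (1 : ℝ) else -1) * f (S i)) '' F

/-- Empirical Rademacher complexity: the expectation over uniform signs is a finite average. -/
def rademacher {X : Type*} {m : ℕ} (S : Fin m → X) (F : Set (X → ℝ)) : ℝ :=
  (m : ℝ)⁻¹ * ((2 : ℝ) ^ m)⁻¹ * ∑ s : Fin m → Bool, sSup (signedSums S F s)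

/-! ### Context-restricted parameters, functions and effective weights -/

/-- The `t × d` data matrix of a context. -/
def dataMatrix {d t : ℕ} (S : Context d t) : Matrix (Fin t) (Fin d) ℝ :=
  Matrix.of fun i k => (S i).1 k

/-- The empirical second-moment matrix `G_t = (1/t) ∑ x_i x_iᵀ`. -/
def gram {d t : ℕ} (S : Context d t) : Matrix (Fin d) (Fin d) ℝ :=
  (t : ℝ)⁻¹ • ((dataMatrix S)ᵀ * dataMatrix S)

/-- The ordinary least squares solution on the context. -/
def ols {d t : ℕ} (S : Context d t) : Fin d → ℝ :=
  ((dataMatrix S)ᵀ * dataMatrix S)⁻¹ *ᵥ ((dataMatrix S)ᵀ *ᵥ fun i => (S i).2)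

/-- `Θ_{S_t}`: the parameters in `Θ` whose attention matrix is within `γ` (Frobenius) of the
matrix `W`. -/
def restrictedParams {d dm : ℕ} (Θ : Set (Param d dm)) (W : Matrix (Fin dm) (Fin dm) ℝ) (γ : ℝ) :
    Set (Param d dm) :=
  {θ ∈ Θ | frobNorm (θ.2 - W) ≤ γ}

/-- The functions realized by a set of parameters. -/
def functionClass {d dm : ℕ} (t : ℕ) (act : ℝ → ℝ) (WV : Matrix (Fin dm) (Fin dm) ℝ)
    (Wc : Fin dm → ℝ) (Θ : Set (Param d dm)) : Set (Prompt d t → ℝ) :=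
  transformer act WV Wc '' Θ

/-- Population risk `E_{x_q ∼ N(0, I_d)} (f(S_t, x_q) - ⟨w, x_q⟩)²` of a linear predictor. -/
def linearRisk {d t : ℕ} (f : Prompt d t → ℝ) (S : Context d t) (w : Vec d) : ℝ :=
  ∫ x, (f (S, x) - inner ℝ w x) ^ 2 ∂stdGaussian (Vec d)

/-- The effective linear weight `G(θ) = argmin_w E (f_θ(S_t, x_q) - ⟨w, x_q⟩)²`. For a Lipschitz
activation the prediction is square integrable in `x_q`, so the minimizer exists and is unique. -/
def effWeight {d dm t : ℕ} (act : ℝ → ℝ) (WV : Matrix (Fin dm) (Fin dm) ℝ) (Wc : Fin dm → ℝ)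
    (S : Context d t) (θ : Param d dm) : Vec d :=
  Classical.epsilon fun w => ∀ v, linearRisk (transformer act WV Wc θ) S w ≤
    linearRisk (transformer act WV Wc θ) S v

/-- The tolerance ellipsoid `{w | (w - ŵ)ᵀ (XᵀX) (w - ŵ) ≤ r}` around the OLS solution. -/
def toleranceEllipsoid {d t : ℕ} (S : Context d t) (r : ℝ) : Set (Vec d) :=
  {w | (w.ofLp - ols S) ⬝ᵥ (((dataMatrix S)ᵀ * dataMatrix S) *ᵥ (w.ofLp - ols S)) ≤ r}

end

end ICL

/-! Two facts combine. On a good event the inputs satisfy `XᵀX ≥ (t/n) I` with `n` depending only on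
`d` and `δ`, so the tolerance ellipsoid lies in a ball of radius of order `√(r/t)` about the OLS
solution. Composing the two Lipschitz hypotheses, `f_θ` is `L_f L_G`-Lipschitz in the effective
weight `G(θ)` for the empirical norm. The class is thus a Lipschitz image of a subset of a ball in
`ℝᵈ`, whatever the number of parameters, and chaining (`sum_iSup_signedSum_le`) gives a complexity
of order `L_f L_G √(r/t) / √m` with a constant depending on `d`. The factors `√D` and `√(log (t/r))`
are bounded below by `1` and `√(log 2)`, so they can be inserted afterwards.

The good event must have a level that works for every `t > d` (`exists_uniform_level`). For large
`t` the weak law puts `G_t` near `I_d`, where coercivity holds with constant `2` and `Ψ` varies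
little. For each of the finitely many remaining `t`, Gaussian inputs almost surely span, so some
finite constant works with probability close to one; the distance of attention matrices is finite
anyway. -/

namespace ICL

open Filter

/-! ### Uniform confidence levels for a sequence of probability spaces -/

/-- Increasing events that exhaust each space, and at some level have probability tending to one
along the sequence, have uniformly high probability at some common level. -/
theorem exists_uniform_level {Ω : ℕ → Type*} [∀ t, MeasurableSpace (Ω t)]
    (P : ∀ t, Measure (Ω t)) [∀ t, IsProbabilityMeasure (P t)] (A : ∀ t, ℕ → Set (Ω t))
    (hmeas : ∀ t n, MeasurableSet (A t n)) (hmono : ∀ t, Monotone (A t)) (d : ℕ)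
    (hfull : ∀ t, d < t → ∀ᵐ x ∂P t, ∃ n, x ∈ A t n) (n₀ : ℕ)
    (hlim : Tendsto (fun t => P t (A t n₀)ᶜ) atTop (𝓝 0)) {ε : ENNReal} (hε : 0 < ε) :
    ∃ n, ∀ t, d < t → P t (A t n)ᶜ ≤ ε := by
  have hpt : ∀ t, d < t → ∃ n, P t (A t n)ᶜ ≤ ε := by
    intro t ht
    have h1 : Tendsto (fun n => P t (A t n)ᶜ) atTop (𝓝 (P t (⋂ n, (A t n)ᶜ))) :=
      tendsto_measure_iInter_atTop (fun n => (hmeas t n).compl.nullMeasurableSet)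
        (fun m n hmn => Set.compl_subset_compl.2 (hmono t hmn)) ⟨0, measure_ne_top _ _⟩
    have h2 : P t (⋂ n, (A t n)ᶜ) = 0 := by
      have := hfull t ht
      rw [ae_iff] at this
      refine measure_mono_null (fun x hx => ?_) this
      simpa using hx
    rw [h2] at h1
    exact (h1.eventually_le_const hε).exists
  obtain ⟨T, hT⟩ := eventually_atTop.1 (hlim.eventually_le_const hε)
  choose! N hN using hpt
  -- Level `n₀` serves all `t ≥ T`; the finitely many smaller `t` each bring their own level.
  refine ⟨max n₀ ((Finset.range T).sup N), fun t ht => ?_⟩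
  have hanti : ∀ {m n : ℕ}, m ≤ n → P t (A t n)ᶜ ≤ P t (A t m)ᶜ := fun h =>
    measure_mono (Set.compl_subset_compl.2 (hmono t h))
  by_cases h : t < T
  · exact (hanti ((Finset.le_sup (f := N) (Finset.mem_range.2 h)).trans (le_max_right _ _))).trans
      (hN t ht)
  · exact (hanti (le_max_left _ _)).trans (hT t (not_lt.1 h))

/-- Weak law of large numbers on finite product spaces. -/
theorem tendsto_measure_pi_average {Ω : Type*} [MeasurableSpace Ω] (ν : Measure Ω)
    [IsProbabilityMeasure ν] {X : Ω → ℝ} (hX : MemLp X 2 ν) {η : ℝ} (hη : 0 < η) :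
    Tendsto (fun t : ℕ => (Measure.pi fun _ : Fin t => ν)
      {x | η ≤ |(t : ℝ)⁻¹ * ∑ i, X (x i) - ν[X]|}) atTop (𝓝 0) := by
  have hbound : ∀ t : ℕ, 0 < t → (Measure.pi fun _ : Fin t => ν)
      {x | η ≤ |(t : ℝ)⁻¹ * ∑ i, X (x i) - ν[X]|} ≤ ENNReal.ofReal (Var[X; ν] / η ^ 2 / t) := by
    intro t ht
    have ht' : (0 : ℝ) < t := by exact_mod_cast ht
    have hmem : ∀ i : Fin t, MemLp (fun x : Fin t → Ω => X (x i)) 2 (Measure.pi fun _ => ν) :=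
      fun i => hX.comp_measurePreserving (measurePreserving_eval (fun _ : Fin t => ν) i)
    have hsum : MemLp (∑ i, fun x : Fin t → Ω => X (x i)) 2 (Measure.pi fun _ => ν) :=
      memLp_finsetSum' _ fun i _ => hmem i
    have hvar : Var[∑ i, fun x : Fin t → Ω => X (x i); Measure.pi fun _ => ν] = t * Var[X; ν] := by
      rw [variance_sum_pi (X := fun _ => X) (fun _ => hX)]
      simp
    have hmean : ∫ x, (∑ i, fun x : Fin t → Ω => X (x i)) x ∂(Measure.pi fun _ : Fin t => ν) =
        t * ν[X] := by
      simp only [Finset.sum_apply]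
      rw [integral_finsetSum _ fun i _ => (hmem i).integrable (by norm_num)]
      have : ∀ i : Fin t, ∫ x : Fin t → Ω, X (x i) ∂(Measure.pi fun _ => ν) = ν[X] := fun i =>
        integral_comp_eval (μ := fun _ : Fin t => ν) (i := i) hX.aestronglyMeasurable
      simp [this]
    -- Chebyshev for the unnormalised sum at deviation `t η`: variance `t Var[X]` over `(t η)²`.
    have := meas_ge_le_variance_div_sq hsum (mul_pos ht' hη)
    rw [hvar, hmean] at this
    refine (measure_mono fun x hx => ?_).trans (this.trans_eq ?_)
    · simp only [Set.mem_ofPred_eq, Finset.sum_apply] at hx ⊢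
      have e : ∑ i, X (x i) - t * ν[X] = t * ((t : ℝ)⁻¹ * ∑ i, X (x i) - ν[X]) := by
        field_simp
      rw [e, abs_mul, abs_of_pos ht']
      gcongr
    · congr 1
      field_simp
  have hlim : Tendsto (fun t : ℕ => ENNReal.ofReal (Var[X; ν] / η ^ 2 / t)) atTop (𝓝 0) := by
    rw [← ENNReal.ofReal_zero]
    exact ENNReal.tendsto_ofReal (tendsto_const_div_atTop_nhds_zero_nat _)
  refine tendsto_of_tendsto_of_tendsto_of_le_of_le' tendsto_const_nhds hlim
    (Eventually.of_forall fun _ => zero_le) ?_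
  filter_upwards [eventually_gt_atTop 0] with t ht using hbound t ht

/-! ### Gaussian design matrices -/

/-- The marginal along `v` is a real Gaussian of variance `‖v‖² > 0`, which has no atoms. -/
theorem stdGaussian_orthogonal_eq_zero {d : ℕ} {v : Vec d} (hv : v ≠ 0) :
    stdGaussian (Vec d) {x | inner ℝ v x = 0} = 0 := by
  have h := IsGaussian.map_eq_gaussianReal (μ := stdGaussian (Vec d)) (innerSL ℝ v)
  rw [variance_dual_stdGaussian, innerSL_apply_norm] at h
  have hne : (‖v‖ ^ 2).toNNReal ≠ 0 := by
    simpa [Real.toNNReal_eq_zero] using hv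
  have := nullSingletonClass_gaussianReal (μ := (stdGaussian (Vec d))[innerSL ℝ v]) hne
  have h0 : ((stdGaussian (Vec d)).map (innerSL ℝ v)) {0} = 0 := by
    rw [h]; exact measure_singleton 0
  rw [Measure.map_apply (by fun_prop) (measurableSet_singleton 0)] at h0
  exact h0

/-- Coordinates have fourth moments, and Hölder with `1/4 + 1/4 = 1/2` applies. This is the square
integrability that the weak law needs for Gram entries. -/
theorem memLp_coord_mul_stdGaussian {d : ℕ} (k l : Fin d) :
    MemLp (fun x : Vec d => x k * x l) 2 (stdGaussian (Vec d)) := by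
  have h : ∀ k : Fin d, MemLp (fun x : Vec d => x k) 4 (stdGaussian (Vec d)) := fun k =>
    (IsGaussian.memLp_id (stdGaussian (Vec d)) 4 (by norm_num)).continuousLinearMap_comp
      (EuclideanSpace.proj (𝕜 := ℝ) k)
  have : ENNReal.HolderTriple 4 4 2 := ⟨by
    rw [← two_mul, show (4 : ENNReal) = 2 * 2 by norm_num,
      ENNReal.mul_inv (by norm_num) (by norm_num), ← mul_assoc,
      ENNReal.mul_inv_cancel (by norm_num) (by norm_num), one_mul]⟩
  exact (h l).mul (h k)

theorem integral_coord_mul_stdGaussian {d : ℕ} (k l : Fin d) :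
    ∫ x : Vec d, x k * x l ∂stdGaussian (Vec d) = (1 : Matrix (Fin d) (Fin d) ℝ) k l := by
  have hm : ∀ k : Fin d, MemLp (fun x : Vec d => x k) 2 (stdGaussian (Vec d)) := fun k =>
    (IsGaussian.memLp_id (stdGaussian (Vec d)) 2 (by norm_num)).continuousLinearMap_comp
      (EuclideanSpace.proj (𝕜 := ℝ) k)
  have h0 : ∀ k : Fin d, ∫ x : Vec d, x k ∂stdGaussian (Vec d) = 0 := fun k =>
    integral_strongDual_stdGaussian (EuclideanSpace.proj (𝕜 := ℝ) k)
  have hc := covariance_eval_multivariateGaussian (μ := (0 : Vec d)) Matrix.PosSemidef.one k l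
  rw [multivariateGaussian_zero_one, covariance_eq_sub (hm k) (hm l), h0 k] at hc
  simpa using hc

/-- The empirical second-moment matrix of the inputs of a context. -/
noncomputable def inputGram {d t : ℕ} (x : Fin t → Vec d) : Matrix (Fin d) (Fin d) ℝ :=
  Matrix.of fun k l => (t : ℝ)⁻¹ * ∑ i, x i k * x i l

theorem gram_eq_inputGram {d t : ℕ} (S : Context d t) : gram S = inputGram fun i => (S i).1 := by
  ext k l
  simp [gram, inputGram, dataMatrix, Matrix.mul_apply]

theorem continuous_inputGram {d t : ℕ} :
    Continuous (inputGram : (Fin t → Vec d) → Matrix (Fin d) (Fin d) ℝ) := by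
  refine continuous_matrix fun k l => ?_
  simp only [inputGram, Matrix.of_apply]
  fun_prop

/-- Empirical second-moment matrices of Gaussian inputs converge to the identity in probability. -/
theorem tendsto_measure_inputGram_notMem {d : ℕ} {U : Set (Matrix (Fin d) (Fin d) ℝ)}
    (hU : U ∈ 𝓝 1) :
    Tendsto (fun t : ℕ => (Measure.pi fun _ : Fin t => stdGaussian (Vec d))
      {x | inputGram x ∉ U}) atTop (𝓝 0) := by
  obtain ⟨η, hη, hηU⟩ : ∃ η > (0 : ℝ), ∀ A : Matrix (Fin d) (Fin d) ℝ,
      (∀ k l, |A k l - (1 : Matrix (Fin d) (Fin d) ℝ) k l| < η) → A ∈ U := by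
    obtain ⟨η, hη, h⟩ := Metric.mem_nhds_iff (α := Fin d → Fin d → ℝ).1 hU
    refine ⟨η, hη, fun A hA => h ?_⟩
    refine (dist_pi_lt_iff hη).2 fun k => (dist_pi_lt_iff hη).2 fun l => ?_
    rw [Real.dist_eq]
    exact hA k l
  have hlim : Tendsto (fun t : ℕ => ∑ k : Fin d, ∑ l : Fin d,
      (Measure.pi fun _ : Fin t => stdGaussian (Vec d))
        {x | η ≤ |(t : ℝ)⁻¹ * ∑ i, x i k * x i l - ∫ x : Vec d, x k * x l ∂stdGaussian (Vec d)|})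
      atTop (𝓝 0) := by
    rw [show (0 : ENNReal) = ∑ k : Fin d, ∑ l : Fin d, 0 by simp]
    exact tendsto_finsetSum _ fun k _ => tendsto_finsetSum _ fun l _ =>
      tendsto_measure_pi_average (stdGaussian (Vec d)) (memLp_coord_mul_stdGaussian k l) hη
  refine tendsto_of_tendsto_of_tendsto_of_le_of_le tendsto_const_nhds hlim
    (fun _ => zero_le) fun t => ?_
  refine (measure_mono (t := ⋃ k : Fin d, ⋃ l : Fin d, {x : Fin t → Vec d | η ≤
    |(t : ℝ)⁻¹ * ∑ i, x i k * x i l - ∫ x : Vec d, x k * x l ∂stdGaussian (Vec d)|})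
    fun x hx => ?_).trans
    ((measure_iUnion_fintype_le _ _).trans
      (Finset.sum_le_sum fun k _ => measure_iUnion_fintype_le _ _))
  by_contra hcon
  refine hx (hηU _ fun k l => ?_)
  simp only [Set.mem_iUnion, Set.mem_ofPred_eq, not_exists, not_le] at hcon
  simpa [inputGram, integral_coord_mul_stdGaussian] using hcon k l

/-- At most `d` independent Gaussian vectors in `ℝᵈ` are almost surely linearly independent. -/
theorem ae_linearIndependent_stdGaussian (d : ℕ) : ∀ n ≤ d,
    ∀ᵐ x ∂(Measure.pi fun _ : Fin n => stdGaussian (Vec d)), LinearIndependent ℝ x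
  | 0, _ => Eventually.of_forall fun x => linearIndependent_empty_type
  | n + 1, hn => by
    have ih := ae_linearIndependent_stdGaussian d n (Nat.le_of_succ_le hn)
    have hmp := measurePreserving_piFinSuccAbove (fun _ : Fin (n + 1) => stdGaussian (Vec d)) 0
    have hopen : IsOpen {x : Fin (n + 1) → Vec d | LinearIndependent ℝ x} :=
      isOpen_setOfPred_linearIndependent
    have hcont : Continuous fun p : Vec d × (Fin n → Vec d) => (Fin.cons p.1 p.2 :
        Fin (n + 1) → Vec d) := by
      refine continuous_pi fun i => ?_
      refine Fin.cases ?_ (fun j => ?_) i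
      · simpa using continuous_fst
      · simp only [Fin.cons_succ]; fun_prop
    have key : ∀ᵐ p ∂(stdGaussian (Vec d)).prod (Measure.pi fun _ : Fin n => stdGaussian (Vec d)),
        LinearIndependent ℝ (Fin.cons p.1 p.2 : Fin (n + 1) → Vec d) := by
      have hms : MeasurableSet {p : Vec d × (Fin n → Vec d) |
          LinearIndependent ℝ (Fin.cons p.1 p.2 : Fin (n + 1) → Vec d)} :=
        (hopen.preimage hcont).measurableSet
      rw [ae_iff]
      change ((stdGaussian (Vec d)).prod (Measure.pi fun _ : Fin n => stdGaussian (Vec d)))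
        {p | LinearIndependent ℝ (Fin.cons p.1 p.2 : Fin (n + 1) → Vec d)}ᶜ = 0
      -- Fubini: with `n < d` independent vectors fixed, a bad new vector lies in their proper span,
      -- hence in a null hyperplane `v⊥`.
      rw [Measure.prod_apply_symm hms.compl, lintegral_eq_zero_iff' ?_]
      · filter_upwards [ih] with y hy
        have hspan : Submodule.span ℝ (Set.range y) ≠ ⊤ := by
          intro h
          have := finrank_span_eq_card hy
          rw [h, finrank_top] at this
          simp at this
          omega
        obtain ⟨v, hv, hv0⟩ := Submodule.exists_mem_ne_zero_of_ne_bot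
          (mt Submodule.orthogonal_eq_bot_iff.1 hspan)
        refine measure_mono_null (fun x hx => ?_) (stdGaussian_orthogonal_eq_zero hv0)
        have hx' : ¬ LinearIndependent ℝ (Fin.cons x y : Fin (n + 1) → Vec d) := hx
        rw [linearIndependent_finCons] at hx'
        have hxm : x ∈ Submodule.span ℝ (Set.range y) := by
          by_contra h; exact hx' ⟨hy, h⟩
        exact Submodule.inner_left_of_mem_orthogonal hxm hv
      · exact (measurable_measure_prodMk_right hms.compl).aemeasurable
    filter_upwards [hmp.quasiMeasurePreserving.ae key] with x hx
    convert hx using 1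
    ext i : 1
    refine Fin.cases ?_ (fun j => ?_) i <;> simp [MeasurableEquiv.piFinSuccAbove]
    rfl

/-- At least `d` independent Gaussian vectors in `ℝᵈ` almost surely span. -/
theorem ae_span_stdGaussian_eq_top (d k : ℕ) :
    ∀ᵐ x ∂(Measure.pi fun _ : Fin (d + k) => stdGaussian (Vec d)),
      Submodule.span ℝ (Set.range x) = ⊤ := by
  induction k with
  | zero =>
    filter_upwards [ae_linearIndependent_stdGaussian d d le_rfl] with x hx
    exact hx.span_eq_top_of_card_eq_finrank' (by simp)
  | succ k ih =>
    have hmp := (measurePreserving_snd (μ := stdGaussian (Vec d))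
      (ν := Measure.pi fun _ : Fin (d + k) => stdGaussian (Vec d))).comp
      (measurePreserving_piFinSuccAbove (fun _ : Fin (d + k + 1) => stdGaussian (Vec d)) 0)
    filter_upwards [hmp.quasiMeasurePreserving.ae ih] with x hx
    rw [eq_top_iff, ← hx]
    refine Submodule.span_mono ?_
    rintro _ ⟨i, rfl⟩
    exact ⟨_, rfl⟩

/-! ### Coercivity of the empirical second-moment matrix -/

theorem sum_inner_sq_eq_inputGram {d t : ℕ} (x : Fin t → Vec d) (v : Vec d) :
    (t : ℝ)⁻¹ * ∑ i, inner ℝ v (x i) ^ 2 = ∑ k, ∑ l, v k * inputGram x k l * v l := by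
  have h : ∀ i, inner ℝ v (x i) ^ 2 = ∑ k, ∑ l, v k * (x i k * x i l) * v l := by
    intro i
    rw [PiLp.inner_apply, sq, Finset.sum_mul_sum]
    refine Finset.sum_congr rfl fun k _ => Finset.sum_congr rfl fun l _ => ?_
    simp only [RCLike.inner_apply, conj_trivial]
    ring
  simp only [h, inputGram, Matrix.of_apply]
  rw [Finset.sum_comm, Finset.mul_sum]
  refine Finset.sum_congr rfl fun k _ => ?_
  rw [Finset.sum_comm, Finset.mul_sum]
  refine Finset.sum_congr rfl fun l _ => ?_
  simp only [Finset.mul_sum, Finset.sum_mul]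
  refine Finset.sum_congr rfl fun i _ => ?_
  ring

/-- Matrices near the identity are uniformly coercive. -/
theorem eventually_nhds_one_coercive (d : ℕ) :
    ∀ᶠ A in 𝓝 (1 : Matrix (Fin d) (Fin d) ℝ),
      ∀ v : Vec d, ‖v‖ ^ 2 ≤ 2 * ∑ k, ∑ l, v k * A k l * v l := by
  -- An entrywise error `η` changes the quadratic form by at most `η (∑ |v k|)² ≤ η d ‖v‖²`; this
  -- `η` makes that at most `‖v‖² / 2`.
  set η : ℝ := (2 * (d + 1))⁻¹ with hη_def
  have hη : 0 < η := by positivity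
  have hnear : ∀ᶠ A in 𝓝 (1 : Matrix (Fin d) (Fin d) ℝ), ∀ k l,
      |A k l - (1 : Matrix (Fin d) (Fin d) ℝ) k l| < η := by
    refine eventually_all.2 fun k => eventually_all.2 fun l => ?_
    have hc : Continuous fun A : Matrix (Fin d) (Fin d) ℝ =>
        |A k l - (1 : Matrix (Fin d) (Fin d) ℝ) k l| :=
      ((continuous_id.matrix_elem k l).sub continuous_const).abs
    exact hc.continuousAt.eventually_lt continuousAt_const (by simpa using hη)
  filter_upwards [hnear] with A hA v
  have hone : ‖v‖ ^ 2 = ∑ k, ∑ l, v k * (1 : Matrix (Fin d) (Fin d) ℝ) k l * v l := by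
    rw [EuclideanSpace.real_norm_sq_eq]
    refine Finset.sum_congr rfl fun k _ => ?_
    simp [Matrix.one_apply, sq]
  have hdiff : ∑ k, ∑ l, v k * (1 : Matrix (Fin d) (Fin d) ℝ) k l * v l -
      ∑ k, ∑ l, v k * A k l * v l ≤ η * (∑ k, |v k|) ^ 2 := by
    rw [sq, Finset.sum_mul_sum, ← Finset.sum_sub_distrib, Finset.mul_sum]
    refine Finset.sum_le_sum fun k _ => ?_
    rw [← Finset.sum_sub_distrib, Finset.mul_sum]
    refine Finset.sum_le_sum fun l _ => ?_
    calc v k * (1 : Matrix (Fin d) (Fin d) ℝ) k l * v l - v k * A k l * v l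
        = (-(A k l - (1 : Matrix (Fin d) (Fin d) ℝ) k l)) * (v k * v l) := by ring
      _ ≤ |(-(A k l - (1 : Matrix (Fin d) (Fin d) ℝ) k l)) * (v k * v l)| := le_abs_self _
      _ = |A k l - (1 : Matrix (Fin d) (Fin d) ℝ) k l| * (|v k| * |v l|) := by
        rw [abs_mul, abs_neg, abs_mul]
      _ ≤ η * (|v k| * |v l|) := by gcongr; exact (hA k l).le
  have hcs : (∑ k, |v k|) ^ 2 ≤ d * ‖v‖ ^ 2 := by
    have := sq_sum_le_card_mul_sum_sq (s := Finset.univ) (f := fun k => |v k|)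
    simpa [EuclideanSpace.real_norm_sq_eq] using this
  have hηd : η * (d * ‖v‖ ^ 2) ≤ ‖v‖ ^ 2 / 2 := by
    have : η * d ≤ 1 / 2 := by
      rw [hη_def, inv_mul_le_iff₀ (by positivity)]
      linarith
    nlinarith [sq_nonneg ‖v‖]
  have := mul_le_mul_of_nonneg_left hcs hη.le
  linarith

/-- The intersection over `v` is uncountable, but its members are closed. -/
theorem measurableSet_coercive {d t : ℕ} (a : ℝ) : MeasurableSet {x : Fin t → Vec d |
    ∀ v : Vec d, ‖v‖ ^ 2 ≤ a * ((t : ℝ)⁻¹ * ∑ i, inner ℝ v (x i) ^ 2)} := by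
  rw [Set.ofPred_forall]
  exact (isClosed_iInter fun v => isClosed_le (by fun_prop) (by fun_prop)).measurableSet

/-- Uniformly in `t > d`, the empirical second-moment matrix of `t` Gaussian inputs in `ℝᵈ` has a
quantitative lower bound with high probability. -/
theorem exists_uniform_coercive (d : ℕ) {ε : ENNReal} (hε : 0 < ε) :
    ∃ n : ℕ, ∀ t, d < t → (Measure.pi fun _ : Fin t => stdGaussian (Vec d))
      {x | ∀ v : Vec d, ‖v‖ ^ 2 ≤ n * ((t : ℝ)⁻¹ * ∑ i, inner ℝ v (x i) ^ 2)}ᶜ ≤ ε := by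
  refine exists_uniform_level (fun t => Measure.pi fun _ : Fin t => stdGaussian (Vec d))
    (fun t n => {x : Fin t → Vec d | ∀ v : Vec d,
      ‖v‖ ^ 2 ≤ n * ((t : ℝ)⁻¹ * ∑ i, inner ℝ v (x i) ^ 2)}) ?_ ?_ d ?_ 2 ?_ hε
  · exact fun t n => measurableSet_coercive n
  · intro t m n hmn x hx v
    refine (hx v).trans ?_
    gcongr
  · intro t ht
    obtain ⟨k, rfl⟩ := Nat.exists_eq_add_of_lt ht
    filter_upwards [ae_span_stdGaussian_eq_top d (k + 1)] with x hx
    -- Spanning makes `T` injective, hence antilipschitz in finite dimension. The codomain carries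
    -- the sup norm, which is dominated by the root of the sum of squares.
    let T : Vec d →ₗ[ℝ] (Fin (d + k + 1) → ℝ) := LinearMap.pi fun i => (innerₗ (Vec d)).flip (x i)
    have hT : ∀ v i, T v i = inner ℝ v (x i) := fun v i => rfl
    have hker : LinearMap.ker T = ⊥ := by
      rw [LinearMap.ker_eq_bot']
      intro v hv
      have hall : ∀ w : Vec d, inner ℝ v w = 0 := by
        intro w
        have hw : w ∈ Submodule.span ℝ (Set.range x) := by
          rw [show Submodule.span ℝ (Set.range x) = ⊤ from hx]; trivial
        induction hw using Submodule.span_induction with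
        | mem y hy =>
          obtain ⟨i, rfl⟩ := hy
          rw [← hT, hv]; rfl
        | zero => simp
        | add y z _ _ hy hz => rw [inner_add_right, hy, hz, add_zero]
        | smul a y _ hy => rw [inner_smul_right, hy, mul_zero]
      exact inner_self_eq_zero.1 (hall v)
    obtain ⟨K, -, hK⟩ := T.exists_antilipschitzWith hker
    obtain ⟨n, hn⟩ := exists_nat_ge ((K : ℝ) ^ 2 * ((d + k + 1 : ℕ) : ℝ))
    refine ⟨n, fun v => ?_⟩
    have h1 : ‖v‖ ≤ K * ‖T v‖ := hK.le_mul_norm (map_zero T) v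
    have h2 : ‖T v‖ ^ 2 ≤ ∑ i, inner ℝ v (x i) ^ 2 := by
      have hs : (0 : ℝ) ≤ ∑ i, inner ℝ v (x i) ^ 2 := Finset.sum_nonneg fun i _ => sq_nonneg _
      have : ‖T v‖ ≤ √(∑ i, inner ℝ v (x i) ^ 2) := by
        refine (pi_norm_le_iff_of_nonneg (Real.sqrt_nonneg _)).2 fun i => ?_
        refine Real.le_sqrt_of_sq_le ?_
        rw [hT, Real.norm_eq_abs, sq_abs]
        exact Finset.single_le_sum (f := fun i => inner ℝ v (x i) ^ 2)
          (fun i _ => sq_nonneg _) (Finset.mem_univ i)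
      calc ‖T v‖ ^ 2 ≤ √(∑ i, inner ℝ v (x i) ^ 2) ^ 2 := by gcongr
        _ = _ := Real.sq_sqrt hs
    have ht0 : (0 : ℝ) < ((d + k + 1 : ℕ) : ℝ) := by positivity
    have hs : (0 : ℝ) ≤ ∑ i, inner ℝ v (x i) ^ 2 := Finset.sum_nonneg fun i _ => sq_nonneg _
    calc ‖v‖ ^ 2 ≤ (K * ‖T v‖) ^ 2 := by gcongr
      _ = K ^ 2 * ‖T v‖ ^ 2 := by ring
      _ ≤ K ^ 2 * ∑ i, inner ℝ v (x i) ^ 2 := by gcongr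
      _ = (K ^ 2 * ((d + k + 1 : ℕ) : ℝ)) *
          (((d + k + 1 : ℕ) : ℝ)⁻¹ * ∑ i, inner ℝ v (x i) ^ 2) := by
        field_simp
      _ ≤ _ := mul_le_mul_of_nonneg_right hn (by positivity)
  · refine tendsto_of_tendsto_of_tendsto_of_le_of_le tendsto_const_nhds
      (tendsto_measure_inputGram_notMem (eventually_nhds_one_coercive d))
      (fun _ => zero_le) fun t => measure_mono fun x hx hxU => hx fun v => ?_
    rw [sum_inner_sq_eq_inputGram]
    exact_mod_cast hxU v

/-! ### Ideal attention matrices and the law of the inputs -/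

theorem continuous_specNorm {n : ℕ} :
    Continuous (specNorm : Matrix (Fin n) (Fin n) ℝ → ℝ) :=
  (LinearMap.continuous_of_finiteDimensional
    (Matrix.toEuclideanCLM (n := Fin n) (𝕜 := ℝ)).toAlgEquiv.toLinearMap).norm

theorem measurable_frobNorm_sub_const {d dm : ℕ}
    {Ψ : Matrix (Fin d) (Fin d) ℝ → Matrix (Fin dm) (Fin dm) ℝ}
    (hΨ : Measurable fun (A : Fin d → Fin d → ℝ) (i j : Fin dm) => Ψ (Matrix.of A) i j)
    (B : Matrix (Fin dm) (Fin dm) ℝ) (t : ℕ) :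
    Measurable fun x : Fin t → Vec d => frobNorm (Ψ (inputGram x) - B) := by
  have hg : Measurable fun (x : Fin t → Vec d) (k l : Fin d) => inputGram x k l := by
    refine measurable_pi_iff.2 fun k => measurable_pi_iff.2 fun l => ?_
    exact (continuous_inputGram.matrix_elem k l).measurable
  have h := hΨ.comp hg
  have hij : ∀ i j, Measurable fun x : Fin t → Vec d => Ψ (inputGram x) i j := fun i j =>
    measurable_pi_iff.1 (measurable_pi_iff.1 h i) j
  simp only [frobNorm, Matrix.sub_apply]
  exact (Finset.measurable_fun_sum _ fun i _ => Finset.measurable_fun_sum _ fun j _ =>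
    ((hij i j).sub_const _).pow_const 2).sqrt

/-- Uniformly in `t > d`, the ideal attention matrix of a Gaussian context is within a fixed
distance of the ideal matrix at the identity with high probability. -/
theorem exists_uniform_attention_bound {d dm : ℕ}
    {Ψ : Matrix (Fin d) (Fin d) ℝ → Matrix (Fin dm) (Fin dm) ℝ}
    (hΨ : Measurable fun (A : Fin d → Fin d → ℝ) (i j : Fin dm) => Ψ (Matrix.of A) i j)
    {L : ℝ} {U : Set (Matrix (Fin d) (Fin d) ℝ)} (hU : U ∈ 𝓝 1)
    (hlip : ∀ G ∈ U, ∀ G' ∈ U, frobNorm (Ψ G - Ψ G') ≤ L * specNorm (G - G'))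
    {ε : ENNReal} (hε : 0 < ε) :
    ∃ n : ℕ, ∀ t, d < t → (Measure.pi fun _ : Fin t => stdGaussian (Vec d))
      {x | frobNorm (Ψ (inputGram x) - Ψ 1) ≤ n}ᶜ ≤ ε := by
  refine exists_uniform_level (fun t => Measure.pi fun _ : Fin t => stdGaussian (Vec d))
    (fun t n => {x : Fin t → Vec d | frobNorm (Ψ (inputGram x) - Ψ 1) ≤ n}) ?_ ?_ d ?_ 1 ?_ hε
  · exact fun t n => measurableSet_le (measurable_frobNorm_sub_const hΨ _ t) measurable_const
  · intro t m n hmn x hx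
    have hx' : frobNorm (Ψ (inputGram x) - Ψ 1) ≤ m := hx
    exact hx'.trans (Nat.cast_le.2 hmn)
  · exact fun t _ => Eventually.of_forall fun x =>
      exists_nat_ge (frobNorm (Ψ (inputGram x) - Ψ 1))
  -- For large `t` the Lipschitz bound near the identity keeps the distance below the chosen level
  -- `1`.
  · have hV : ∀ᶠ G in 𝓝 (1 : Matrix (Fin d) (Fin d) ℝ), G ∈ U ∧ L * specNorm (G - 1) < 1 := by
      refine (show ∀ᶠ G in 𝓝 (1 : Matrix (Fin d) (Fin d) ℝ), G ∈ U from hU).and ?_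
      have hc : Continuous fun G : Matrix (Fin d) (Fin d) ℝ => L * specNorm (G - 1) :=
        continuous_const.mul (continuous_specNorm.comp (continuous_id.sub continuous_const))
      exact hc.continuousAt.eventually_lt continuousAt_const (by simp [specNorm])
    refine tendsto_of_tendsto_of_tendsto_of_le_of_le tendsto_const_nhds
      (tendsto_measure_inputGram_notMem hV)
      (fun _ => zero_le) fun t => measure_mono fun x hx hxU => hx ?_
    simpa using (hlip _ hxU.1 _ (mem_of_mem_nhds hU)).trans hxU.2.le

/-- The inputs of a context are i.i.d. standard Gaussian. -/
theorem measurePreserving_inputs (d t : ℕ) :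
    MeasurePreserving (fun (S : Context d t) i => (S i).1) (contextLaw d t)
      (Measure.pi fun _ : Fin t => stdGaussian (Vec d)) := by
  have hm : Measurable fun (S : Context d t) i => (S i).1 := by fun_prop
  refine ⟨hm, ?_⟩
  rw [contextLaw, Measure.map_map hm]
  · exact (measurePreserving_snd (μ := multivariateGaussian (0 : Vec d)
      ((d : ℝ)⁻¹ • (1 : Matrix (Fin d) (Fin d) ℝ)))
      (ν := Measure.pi fun _ : Fin t => stdGaussian (Vec d))).map_eq
  · fun_prop

/-! ### Chaining for Rademacher sums -/

/-- The signed sum of a vector. -/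
noncomputable def signedSum {m : ℕ} (s : Fin m → Bool) (v : Fin m → ℝ) : ℝ :=
  ∑ i, (if s i then (1 : ℝ) else -1) * v i

theorem signedSum_sub {m : ℕ} (s : Fin m → Bool) (v w : Fin m → ℝ) :
    signedSum s (v - w) = signedSum s v - signedSum s w := by
  simp [signedSum, mul_sub, Finset.sum_sub_distrib]

/-- Flipping every sign negates the sum. This removes the base point of the chain on average. -/
theorem sum_signedSum {m : ℕ} (v : Fin m → ℝ) : ∑ s : Fin m → Bool, signedSum s v = 0 := by
  have h : ∑ s : Fin m → Bool, signedSum s v = ∑ s : Fin m → Bool, -signedSum s v := by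
    refine Fintype.sum_equiv (Equiv.piCongrRight fun _ => Equiv.boolNot) _ _ fun s => ?_
    simp only [signedSum, ← Finset.sum_neg_distrib]
    refine Finset.sum_congr rfl fun i _ => ?_
    by_cases hs : s i <;> simp [hs]
  rw [Finset.sum_neg_distrib] at h
  linarith

/-- The crude factor `m` is harmless: the bound serves only for zero vectors and for a chaining
remainder that tends to zero. -/
theorem signedSum_le {m : ℕ} (s : Fin m → Bool) (v : Fin m → ℝ) :
    signedSum s v ≤ m * √(∑ i, v i ^ 2) := by
  have : ∀ i, (if s i then (1 : ℝ) else -1) * v i ≤ √(∑ i, v i ^ 2) := by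
    intro i
    refine (le_abs_self _).trans (Real.le_sqrt_of_sq_le ?_)
    have : |(if s i then (1 : ℝ) else -1) * v i| ^ 2 = v i ^ 2 := by
      rw [sq_abs]; split_ifs <;> ring
    rw [this]
    exact Finset.single_le_sum (f := fun i => v i ^ 2) (fun i _ => sq_nonneg _)
      (Finset.mem_univ i)
  calc signedSum s v ≤ ∑ _i : Fin m, √(∑ i, v i ^ 2) := Finset.sum_le_sum fun i _ => this i
    _ = _ := by simp

/-- Sub-Gaussian bound for the moment generating function of a Rademacher sum. -/
theorem sum_exp_signedSum_le {m : ℕ} (v : Fin m → ℝ) :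
    ∑ s : Fin m → Bool, Real.exp (signedSum s v) ≤ 2 ^ m * Real.exp ((∑ i, v i ^ 2) / 2) := by
  -- Independence of the signs: the sum over sign patterns factors into one `2 cosh (v i)` per
  -- coordinate.
  have h := Finset.prod_univ_sum (fun _ : Fin m => (Finset.univ : Finset Bool))
    (fun i b => Real.exp ((if b then (1 : ℝ) else -1) * v i))
  rw [Fintype.piFinset_univ] at h
  simp only [signedSum, Real.exp_sum]
  rw [← h]
  calc ∏ i, ∑ b : Bool, Real.exp ((if b then (1 : ℝ) else -1) * v i)
      = ∏ i, 2 * Real.cosh (v i) := by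
        refine Finset.prod_congr rfl fun i _ => ?_
        rw [Real.cosh_eq]
        simp
        ring
    _ ≤ ∏ i, 2 * Real.exp (v i ^ 2 / 2) := by
        refine Finset.prod_le_prod (fun i _ => ?_) fun i _ => ?_
        · have := Real.cosh_pos (v i)
          positivity
        · exact mul_le_mul_of_nonneg_left (Real.cosh_le_exp_half_sq _) zero_le_two
    _ = _ := by
        rw [Finset.prod_mul_distrib, ← Real.exp_sum, Finset.sum_div]
        simp

/-- Finite maximal inequality: finitely many Rademacher sums have a common upper envelope of small
mean. -/
theorem exists_envelope {ι : Type*} {m N : ℕ} (v : ι → Fin m → ℝ) (hfin : (Set.range v).Finite)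
    (hN : 0 < N) (hcard : (Set.range v).ncard ≤ N) {b : ℝ} (hb : 0 ≤ b)
    (hv : ∀ a, √(∑ i, v a i ^ 2) ≤ b) :
    ∃ M : (Fin m → Bool) → ℝ, (∀ s a, signedSum s (v a) ≤ M s) ∧
      ∑ s, M s ≤ 2 ^ m * (b * (Real.log N + 1)) := by
  rcases hb.eq_or_lt with rfl | hb
  · refine ⟨fun _ => 0, fun s a => ?_, by simp⟩
    have h0 : √(∑ i, v a i ^ 2) = 0 := le_antisymm (hv a) (Real.sqrt_nonneg _)
    simpa [h0] using signedSum_le s (v a)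
  have hN' : (0 : ℝ) < N := by exact_mod_cast hN
  have hscale : ∀ (s : Fin m → Bool) (w : Fin m → ℝ),
      signedSum s (fun i => w i / b) = signedSum s w / b := by
    intro s w
    simp only [signedSum, Finset.sum_div, mul_div_assoc]
  -- The tangent bound `x ≤ log N - 1 + exp x / N` replaces the logarithm of a sum of exponentials
  -- by the sum itself, which can be averaged without Jensen. It yields `log N` instead of `√(log
  -- N)`, which dyadic chaining in `ℝᵈ` can afford.
  refine ⟨fun s => b * (Real.log N - 1 +
    (∑ w ∈ hfin.toFinset, Real.exp (signedSum s fun i => w i / b)) / N), fun s a => ?_, ?_⟩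
  · have h1 : Real.exp (signedSum s fun i => v a i / b) ≤
        ∑ w ∈ hfin.toFinset, Real.exp (signedSum s fun i => w i / b) :=
      Finset.single_le_sum (f := fun w : Fin m → ℝ => Real.exp (signedSum s fun i => w i / b))
        (fun _ _ => (Real.exp_pos _).le) (by simp)
    have h2 := Real.add_one_le_exp (signedSum s (v a) / b - Real.log N)
    rw [Real.exp_sub, Real.exp_log hN', ← hscale] at h2
    have h3 := h2.trans (div_le_div_of_nonneg_right h1 hN'.le)
    rw [hscale] at h3
    rw [← div_le_iff₀' hb]
    linarith
  · have hexp : ∑ s : Fin m → Bool, ∑ w ∈ hfin.toFinset,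
        Real.exp (signedSum s fun i => w i / b) ≤ N * (2 ^ m * 2) := by
      rw [Finset.sum_comm]
      calc ∑ w ∈ hfin.toFinset, ∑ s : Fin m → Bool, Real.exp (signedSum s fun i => w i / b)
          ≤ ∑ w ∈ hfin.toFinset, (2 ^ m * 2 : ℝ) := by
            refine Finset.sum_le_sum fun w hw => ?_
            obtain ⟨a, rfl⟩ := hfin.mem_toFinset.1 hw
            refine (sum_exp_signedSum_le _).trans ?_
            have hle : (∑ i, (v a i / b) ^ 2) / 2 ≤ 1 / 2 := by
              have : ∑ i, v a i ^ 2 ≤ b ^ 2 := (Real.sqrt_le_left hb.le).1 (hv a)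
              simp only [div_pow, ← Finset.sum_div]
              gcongr
              exact (div_le_one (by positivity)).2 this
            have h2 : Real.exp (1 / 2) ≤ 2 := by
              rw [← Real.le_log_iff_exp_le (by norm_num)]
              linarith [Real.log_two_gt_d9]
            gcongr
            exact (Real.exp_le_exp.2 hle).trans h2
        _ = (Set.range v).ncard * (2 ^ m * 2) := by
            rw [Finset.sum_const, nsmul_eq_mul, Set.ncard_eq_toFinset_card _ hfin]
        _ ≤ _ := by gcongr
    rw [← Finset.mul_sum, Finset.sum_add_distrib, ← Finset.sum_div]
    have h4 : (∑ s : Fin m → Bool, ∑ w ∈ hfin.toFinset,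
        Real.exp (signedSum s fun i => w i / b)) / N ≤ 2 ^ m * 2 :=
      (div_le_iff₀' hN').2 hexp
    have h5 : ∑ _s : Fin m → Bool, (Real.log N - 1) = 2 ^ m * (Real.log N - 1) := by
      rw [Finset.sum_const, nsmul_eq_mul]
      simp
    rw [h5]
    calc b * (2 ^ m * (Real.log N - 1) + _) ≤ b * (2 ^ m * (Real.log N - 1) + 2 ^ m * 2) := by
          gcongr
      _ = _ := by ring

/-- Dyadic nets of a family of points in a ball of `ℝᵈ`, with net points taken from the family. -/
theorem exists_net {ι : Type*} {d : ℕ} (g : ι → Vec d) (c : Vec d) {R : ℝ} (hR : 0 < R)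
    (hg : ∀ a, ‖g a - c‖ ≤ R) (a₀ : ι) (k : ℕ) :
    ∃ p : ι → ι, (∀ a, ‖g a - g (p a)‖ ≤ (d + 2) * R / 2 ^ k) ∧ (Set.range p).Finite ∧
      (Set.range p).ncard ≤ 2 ^ ((k + 2) * d) ∧ (k = 0 → ∀ a, p a = a₀) := by
  -- At `k = 0` one point suffices, since the diameter `2 R` is at most `(d + 2) R`; every chain
  -- then starts at `a₀`.
  rcases Nat.eq_zero_or_pos k with rfl | hk
  · refine ⟨fun _ => a₀, fun a => ?_, Set.finite_range_const, ?_, fun _ _ => rfl⟩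
    · calc ‖g a - g a₀‖ = ‖(g a - c) - (g a₀ - c)‖ := by congr 1; abel
        _ ≤ ‖g a - c‖ + ‖g a₀ - c‖ := norm_sub_le _ _
        _ ≤ R + R := add_le_add (hg a) (hg a₀)
        _ ≤ _ := by
          have : (0 : ℝ) ≤ d * R := by positivity
          simp only [pow_zero, div_one]
          linarith
    · have : (Set.range fun _ : ι => a₀) ⊆ {a₀} := by rintro _ ⟨_, rfl⟩; rfl
      exact (Set.ncard_le_ncard this).trans (by simpa using Nat.one_le_two_pow)
  have hcoord : ∀ a j, |(g a j - c j) / R| ≤ 1 := by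
    intro a j
    rw [abs_div, abs_of_pos hR, div_le_one hR]
    exact (PiLp.norm_apply_le (g a - c) j).trans (hg a)
  -- Grid cell of mesh `R / 2 ^ k` containing `g a`. The net point of `a` is a chosen member of the
  -- family in the same cell.
  let q : ι → Fin d → Finset.Icc (-2 ^ k : ℤ) (2 ^ k) := fun a j =>
    ⟨⌊2 ^ k * ((g a j - c j) / R)⌋, by
      have h := abs_le.1 (hcoord a j)
      have h2 : (0 : ℝ) < 2 ^ k := by positivity
      rw [Finset.mem_Icc]
      constructor
      · rw [Int.le_floor]; push_cast; nlinarith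
      · have : (⌊2 ^ k * ((g a j - c j) / R)⌋ : ℝ) ≤ 2 ^ k :=
          (Int.floor_le _).trans (by nlinarith)
        exact_mod_cast this⟩
  have : Nonempty ι := ⟨a₀⟩
  have hq : ∀ a, q (Function.invFun q (q a)) = q a := fun a =>
    Function.invFun_eq ⟨a, rfl⟩
  have hfin : (Set.range (Function.invFun q)).Finite := Set.finite_range _
  have hsub : Set.range (fun a => Function.invFun q (q a)) ⊆ Set.range (Function.invFun q) := by
    rintro _ ⟨a, rfl⟩; exact ⟨_, rfl⟩
  refine ⟨fun a => Function.invFun q (q a), fun a => ?_, hfin.subset hsub, ?_,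
    fun h => absurd h hk.ne'⟩
  · set b := Function.invFun q (q a)
    have hj : ∀ j, ‖(g a - g b) j‖ ≤ R / 2 ^ k := by
      intro j
      have h1 : ⌊2 ^ k * ((g a j - c j) / R)⌋ = ⌊2 ^ k * ((g b j - c j) / R)⌋ :=
        congrArg Subtype.val (congrFun (hq a).symm j)
      have h2 := (Int.abs_sub_lt_one_of_floor_eq_floor h1).le
      rw [show (2 : ℝ) ^ k * ((g a j - c j) / R) - 2 ^ k * ((g b j - c j) / R) =
        (g a j - g b j) / (R / 2 ^ k) by field_simp; ring, abs_div,
        abs_of_pos (by positivity : 0 < R / 2 ^ k), div_le_one (by positivity)] at h2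
      exact h2
    calc ‖g a - g b‖ = √(∑ j, ‖(g a - g b) j‖ ^ 2) := EuclideanSpace.norm_eq _
      _ ≤ √((d * (R / 2 ^ k)) ^ 2) := by
        refine Real.sqrt_le_sqrt ?_
        calc ∑ j, ‖(g a - g b) j‖ ^ 2 ≤ ∑ _j : Fin d, (R / 2 ^ k) ^ 2 :=
              Finset.sum_le_sum fun j _ => by gcongr; exact hj j
          _ = d * (R / 2 ^ k) ^ 2 := by simp
          _ ≤ (d : ℝ) ^ 2 * (R / 2 ^ k) ^ 2 := by
              gcongr
              exact_mod_cast Nat.le_self_pow two_ne_zero d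
          _ = _ := by ring
      _ = d * (R / 2 ^ k) := Real.sqrt_sq (by positivity)
      _ ≤ _ := by
        rw [mul_div_assoc]
        gcongr
        linarith
  · calc (Set.range fun a => Function.invFun q (q a)).ncard
        ≤ (Set.range (Function.invFun q)).ncard := Set.ncard_le_ncard hsub hfin
      _ ≤ Nat.card (Fin d → Finset.Icc (-2 ^ k : ℤ) (2 ^ k)) := by
        rw [← Set.image_univ, ← Set.ncard_univ]
        exact Set.ncard_image_le Set.finite_univ
      _ = (2 ^ k + 1 + 2 ^ k) ^ d := by
        rw [Nat.card_eq_fintype_card, Fintype.card_fun]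
        simp only [Fintype.card_coe, Int.card_Icc, Fintype.card_fin]
        congr 1
        have : ((2 : ℤ) ^ k + 1 - -2 ^ k) = ((2 ^ k + 1 + 2 ^ k : ℕ) : ℤ) := by push_cast; ring
        rw [this, Int.toNat_natCast]
      _ ≤ (2 ^ (k + 2)) ^ d := by
        gcongr
        have : 1 ≤ 2 ^ k := Nat.one_le_two_pow
        rw [pow_add]
        omega
      _ = _ := (pow_mul _ _ _).symm

/-- The full series is `14 = 4 + 10`, and the partial sums have an explicit tail. The weights `2 k +
5` come from the entropy of the level-`k` links. -/
theorem sum_dyadic_weights_le (K : ℕ) :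
    ∑ k ∈ Finset.range K, (2 * k + 5 : ℝ) / 2 ^ k ≤ 14 := by
  have h : ∑ k ∈ Finset.range K, (2 * k + 5 : ℝ) / 2 ^ k = 14 - (4 * K + 14) / 2 ^ K := by
    induction K with
    | zero => simp
    | succ K ih =>
      rw [Finset.sum_range_succ, ih]
      push_cast
      field_simp
      ring
  rw [h]
  have : (0 : ℝ) ≤ (4 * K + 14) / 2 ^ K := by positivity
  linarith

theorem sum_dyadic_le (K : ℕ) : ∑ k ∈ Finset.range K, (1 : ℝ) / 2 ^ k ≤ 2 := by
  have h := sum_geometric_two_le K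
  simpa using h

/-- Chaining bound for the Rademacher averages of a family that is Lipschitz in a parameter ranging
over a ball of `ℝᵈ`. -/
theorem sum_iSup_signedSum_le {ι : Type*} [Nonempty ι] {d m : ℕ} (g : ι → Vec d)
    (F : ι → Fin m → ℝ) (c : Vec d) {R : ℝ} (hR : 0 < R) (hg : ∀ a, ‖g a - c‖ ≤ R) {Λ : ℝ}
    (hΛ : 0 ≤ Λ) (hF : ∀ a b, √(∑ i, (F a i - F b i) ^ 2) ≤ Λ * ‖g a - g b‖) :
    (∀ s, BddAbove (Set.range fun a => signedSum s (F a))) ∧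
      ∑ s, ⨆ a, signedSum s (F a) ≤ 2 ^ m * (2 * (d + 2) * (14 * d + 2) * (Λ * R)) := by
  obtain ⟨a₀⟩ := ‹Nonempty ι›
  choose p hpd hpf hpc hp0 using exists_net g c hR hg a₀
  set B : ℝ := (d + 2) * R with hB
  have hB0 : 0 ≤ B := by positivity
  -- Level-`k` links join points of consecutive nets: at most `2 ^ ((k + 3) d) * 2 ^ ((k + 2) d)` of
  -- them, each of length at most `2 Λ B / 2 ^ k`.
  have henv : ∀ k, ∃ M : (Fin m → Bool) → ℝ,
      (∀ s a, signedSum s (F (p (k + 1) a) - F (p k a)) ≤ M s) ∧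
      ∑ s, M s ≤ 2 ^ m * (2 * (Λ * B) * (d * ((2 * k + 5) / 2 ^ k) + 1 / 2 ^ k)) := by
    intro k
    have hsub : Set.range (fun a => F (p (k + 1) a) - F (p k a)) ⊆
        (fun u : ι × ι => F u.1 - F u.2) '' (Set.range (p (k + 1)) ×ˢ Set.range (p k)) := by
      rintro _ ⟨a, rfl⟩
      exact ⟨(p (k + 1) a, p k a), ⟨⟨a, rfl⟩, ⟨a, rfl⟩⟩, rfl⟩
    have hfin := (hpf (k + 1)).prod (hpf k)
    have hcard : (Set.range fun a => F (p (k + 1) a) - F (p k a)).ncard ≤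
        2 ^ ((2 * k + 5) * d) := by
      calc _ ≤ _ := Set.ncard_le_ncard hsub (hfin.image _)
        _ ≤ (Set.range (p (k + 1)) ×ˢ Set.range (p k)).ncard := Set.ncard_image_le hfin
        _ = (Set.range (p (k + 1))).ncard * (Set.range (p k)).ncard := Set.ncard_prod
        _ ≤ 2 ^ ((k + 1 + 2) * d) * 2 ^ ((k + 2) * d) := Nat.mul_le_mul (hpc _) (hpc _)
        _ = _ := by rw [← pow_add]; congr 1; ring
    have hlen : ∀ a, √(∑ i, (F (p (k + 1) a) - F (p k a)) i ^ 2) ≤ 2 * (Λ * B) / 2 ^ k := by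
      intro a
      refine (hF _ _).trans ?_
      calc Λ * ‖g (p (k + 1) a) - g (p k a)‖
          = Λ * ‖(g a - g (p k a)) - (g a - g (p (k + 1) a))‖ := by congr 2; abel
        _ ≤ Λ * (B / 2 ^ k + B / 2 ^ k) := by
          gcongr
          refine (norm_sub_le _ _).trans (add_le_add (hpd k a) ((hpd (k + 1) a).trans ?_))
          gcongr
          · norm_num
          · omega
        _ = _ := by ring
    obtain ⟨M, hM, hMs⟩ := exists_envelope _ ((hfin.image _).subset hsub) (by positivity) hcard
      (by positivity) hlen
    refine ⟨M, hM, hMs.trans ?_⟩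
    have hlog : Real.log ((2 ^ ((2 * k + 5) * d) : ℕ) : ℝ) ≤ (2 * k + 5) * d := by
      push_cast
      rw [Real.log_pow]
      push_cast
      have := Real.log_two_lt_d9
      have h0 : (0 : ℝ) ≤ (2 * k + 5) * d := by positivity
      nlinarith
    calc (2 : ℝ) ^ m * (2 * (Λ * B) / 2 ^ k * (Real.log ((2 ^ ((2 * k + 5) * d) : ℕ) : ℝ) + 1))
        ≤ 2 ^ m * (2 * (Λ * B) / 2 ^ k * ((2 * k + 5) * d + 1)) := by gcongr
      _ = _ := by ring
  choose M hM hMs using henv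
  have hupper : ∀ K s a, signedSum s (F a) ≤
      signedSum s (F a₀) + ∑ k ∈ Finset.range K, M k s + m * (Λ * (B / 2 ^ K)) := by
    intro K s a
    have htel : signedSum s (F (p K a)) - signedSum s (F (p 0 a)) ≤
        ∑ k ∈ Finset.range K, M k s := by
      rw [← Finset.sum_range_sub (fun k => signedSum s (F (p k a)))]
      refine Finset.sum_le_sum fun k _ => ?_
      rw [← signedSum_sub]
      exact hM k s a
    rw [hp0 0 rfl] at htel
    have hlast : signedSum s (F a) - signedSum s (F (p K a)) ≤ m * (Λ * (B / 2 ^ K)) := by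
      rw [← signedSum_sub]
      refine (signedSum_le _ _).trans ?_
      gcongr
      refine (hF _ _).trans ?_
      gcongr
      exact hpd K a
    linarith
  have : Nonempty ι := ⟨a₀⟩
  refine ⟨fun s => ⟨_, Set.forall_mem_range.2 (hupper 0 s)⟩, ?_⟩
  -- Stopping the chain at level `K` leaves a remainder proportional to `2 ^ (-K)`; letting `K` tend
  -- to infinity removes its dependence on `m`.
  have hK : ∀ K : ℕ, ∑ s, ⨆ a, signedSum s (F a) ≤
      2 ^ m * (2 * (d + 2) * (14 * d + 2) * (Λ * R)) + 2 ^ m * (m * (Λ * B)) * (1 / 2) ^ K := by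
    intro K
    have hsumM : ∑ s, ∑ k ∈ Finset.range K, M k s ≤
        2 ^ m * (2 * (d + 2) * (14 * d + 2) * (Λ * R)) := by
      rw [Finset.sum_comm]
      calc ∑ k ∈ Finset.range K, ∑ s, M k s
          ≤ ∑ k ∈ Finset.range K,
            2 ^ m * (2 * (Λ * B) * (d * ((2 * k + 5) / 2 ^ k) + 1 / 2 ^ k)) :=
            Finset.sum_le_sum fun k _ => hMs k
        _ = 2 ^ m * (2 * (Λ * B) * (d * (∑ k ∈ Finset.range K, (2 * k + 5 : ℝ) / 2 ^ k) +
            ∑ k ∈ Finset.range K, (1 : ℝ) / 2 ^ k)) := by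
            rw [← Finset.mul_sum, ← Finset.mul_sum, Finset.sum_add_distrib, ← Finset.mul_sum]
        _ ≤ 2 ^ m * (2 * (Λ * B) * (d * 14 + 2)) := by
            gcongr
            · exact sum_dyadic_weights_le K
            · exact sum_dyadic_le K
        _ = _ := by rw [hB]; ring
    calc ∑ s, ⨆ a, signedSum s (F a)
        ≤ ∑ s, (signedSum s (F a₀) + ∑ k ∈ Finset.range K, M k s + m * (Λ * (B / 2 ^ K))) :=
          Finset.sum_le_sum fun s _ => ciSup_le fun a => hupper K s a
      _ = ∑ s, ∑ k ∈ Finset.range K, M k s + 2 ^ m * (m * (Λ * B)) * (1 / 2) ^ K := by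
          rw [Finset.sum_add_distrib, Finset.sum_add_distrib, sum_signedSum, zero_add]
          congr 1
          simp
          ring
      _ ≤ _ := by gcongr
  have hlim : Tendsto (fun K : ℕ => 2 ^ m * (2 * (d + 2) * (14 * d + 2) * (Λ * R)) +
      2 ^ m * (m * (Λ * B)) * (1 / 2 : ℝ) ^ K) atTop
      (𝓝 (2 ^ m * (2 * (d + 2) * (14 * d + 2) * (Λ * R)) + 2 ^ m * (m * (Λ * B)) * 0)) :=
    tendsto_const_nhds.add ((tendsto_pow_atTop_nhds_zero_of_lt_one (by norm_num)
      (by norm_num)).const_mul _)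
  rw [mul_zero, add_zero] at hlim
  exact ge_of_tendsto' hlim hK

/-! ### The context-restricted function class -/

theorem frobNorm_eq_norm {n k : ℕ} (A : Matrix (Fin n) (Fin k) ℝ) :
    frobNorm A = ‖WithLp.toLp 2 (fun p : Fin n × Fin k => A p.1 p.2)‖ := by
  simp [frobNorm, EuclideanSpace.norm_eq, Fintype.sum_prod_type]

theorem frobNorm_add_le {n k : ℕ} (A B : Matrix (Fin n) (Fin k) ℝ) :
    frobNorm (A + B) ≤ frobNorm A + frobNorm B := by
  simp only [frobNorm_eq_norm]
  exact norm_add_le (WithLp.toLp 2 fun p : Fin n × Fin k => A p.1 p.2)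
    (WithLp.toLp 2 fun p : Fin n × Fin k => B p.1 p.2)

theorem frobNorm_sub_comm {n k : ℕ} (A B : Matrix (Fin n) (Fin k) ℝ) :
    frobNorm (A - B) = frobNorm (B - A) := by
  simp only [frobNorm, Matrix.sub_apply, sub_sq_comm]

theorem restrictedParams_subset {d dm : ℕ} (Θ : Set (Param d dm))
    (W W' : Matrix (Fin dm) (Fin dm) ℝ) {γ γ' : ℝ} (h : γ + frobNorm (W' - W) ≤ γ') :
    restrictedParams Θ W γ ⊆ restrictedParams Θ W' γ' := by
  rintro θ ⟨hθ, hγ⟩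
  refine ⟨hθ, ?_⟩
  calc frobNorm (θ.2 - W') = frobNorm ((θ.2 - W) + (W - W')) := by rw [sub_add_sub_cancel]
    _ ≤ frobNorm (θ.2 - W) + frobNorm (W - W') := frobNorm_add_le _ _
    _ ≤ γ + frobNorm (W' - W) := by rw [frobNorm_sub_comm W W']; gcongr
    _ ≤ γ' := h

theorem mem_toleranceEllipsoid_iff {d t : ℕ} {S : Context d t} {r : ℝ} {w : Vec d} :
    w ∈ toleranceEllipsoid S r ↔
      ∑ i, inner ℝ (w - WithLp.toLp 2 (ols S)) (S i).1 ^ 2 ≤ r := by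
  have h : ∀ v : Fin d → ℝ, v ⬝ᵥ (((dataMatrix S)ᵀ * dataMatrix S) *ᵥ v) =
      ∑ i, inner ℝ (WithLp.toLp 2 v) (S i).1 ^ 2 := by
    intro v
    rw [← Matrix.mulVec_mulVec, Matrix.dotProduct_mulVec, Matrix.vecMul_transpose]
    refine Finset.sum_congr rfl fun i _ => ?_
    rw [← sq]
    congr 1
  rw [toleranceEllipsoid, Set.mem_ofPred_eq, h]
  rfl

/-- Chaining is indexed by parameters, because the effective weight is attached to `θ` and not to
the function `f_θ`. -/
theorem signedSums_functionClass {d dm t m : ℕ} (act : ℝ → ℝ) (WV : Matrix (Fin dm) (Fin dm) ℝ)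
    (Wc : Fin dm → ℝ) (Θ : Set (Param d dm)) (Z : Fin m → Prompt d t) (s : Fin m → Bool) :
    signedSums Z (functionClass t act WV Wc Θ) s =
      Set.range fun θ : Θ => signedSum s fun i => transformer act WV Wc θ.1 (Z i) := by
  rw [signedSums, functionClass, Set.image_image, Set.image_eq_range]
  rfl

/-- Rademacher complexity of a class of Transformers that is Lipschitz in an effective weight
ranging over a ball. -/
theorem rademacher_functionClass_le {d dm t m : ℕ} (hm : 0 < m) (act : ℝ → ℝ)
    (WV : Matrix (Fin dm) (Fin dm) ℝ) (Wc : Fin dm → ℝ) (Θ : Set (Param d dm))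
    (Z : Fin m → Prompt d t) (g : Param d dm → Vec d) (c : Vec d) {R L : ℝ} (hR : 0 < R)
    (hL : 0 ≤ L) (hg : ∀ θ ∈ Θ, ‖g θ - c‖ ≤ R)
    (hf : ∀ θ₁ ∈ Θ, ∀ θ₂ ∈ Θ,
      empNorm Z (transformer act WV Wc θ₁ - transformer act WV Wc θ₂) ≤ L * ‖g θ₁ - g θ₂‖) :
    (∀ s, BddAbove (signedSums Z (functionClass t act WV Wc Θ) s)) ∧
      rademacher Z (functionClass t act WV Wc Θ) ≤
        2 * (d + 2) * (14 * d + 2) * (L * R) / √m := by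
  have hm' : (0 : ℝ) < m := by exact_mod_cast hm
  simp only [rademacher, signedSums_functionClass]
  rcases isEmpty_or_nonempty Θ with hΘ | hΘ
  -- For an empty class `sSup ∅ = 0`, so the complexity is `0`.
  · refine ⟨fun s => by simp, ?_⟩
    simp only [Set.range_eq_empty, Real.sSup_empty, Finset.sum_const_zero, mul_zero]
    positivity
  have hF : ∀ a b : Θ, √(∑ i, (transformer act WV Wc a.1 (Z i) -
      transformer act WV Wc b.1 (Z i)) ^ 2) ≤ (√m * L) * ‖g a.1 - g b.1‖ := by
    intro a b
    have h := hf a a.2 b b.2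
    -- Passing from the empirical to the Euclidean norm costs `√m`; against the prefactor `1 / m`
    -- this leaves `1 / √m`.
    rw [empNorm, Real.sqrt_div' _ hm'.le, div_le_iff₀' (by positivity), ← mul_assoc] at h
    exact h
  obtain ⟨hbdd, hsum⟩ := sum_iSup_signedSum_le (fun θ : Θ => g θ.1)
    (fun (θ : Θ) i => transformer act WV Wc θ.1 (Z i)) c hR (fun θ => hg θ.1 θ.2)
    (by positivity) hF
  refine ⟨hbdd, ?_⟩
  calc (m : ℝ)⁻¹ * ((2 : ℝ) ^ m)⁻¹ * ∑ s : Fin m → Bool, sSup (Set.range fun θ : Θ =>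
        signedSum s fun i => transformer act WV Wc θ.1 (Z i))
      ≤ (m : ℝ)⁻¹ * ((2 : ℝ) ^ m)⁻¹ *
        (2 ^ m * (2 * (d + 2) * (14 * d + 2) * (√m * L * R))) := by gcongr; exact hsum
    _ = 2 * (d + 2) * (14 * d + 2) * (L * R) * (√m / m) := by field_simp
    _ = _ := by rw [Real.sqrt_div_self, div_eq_mul_inv]

instance isProbabilityMeasure_contextLaw (d t : ℕ) : IsProbabilityMeasure (contextLaw d t) :=
  Measure.isProbabilityMeasure_map (by fun_prop)

end ICL

theorem mainTheorem1 (d : ℕ) (hd : 0 < d) (δ : ℝ) (hδ₀ : 0 < δ) (hδ₁ : δ < 1) :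
    ∃ C : ℝ, 0 < C ∧
      ∀ (dm : ℕ), 0 < dm →
      -- the ideal attention matrices are `W*(S_t) = Ψ (G_t)` and `W* = Ψ (I_d)`
      ∀ Ψ : Matrix (Fin d) (Fin d) ℝ → Matrix (Fin dm) (Fin dm) ℝ,
      Measurable (fun (A : Fin d → Fin d → ℝ) (i j : Fin dm) => Ψ (Matrix.of A) i j) →
      (∃ LΨ : ℝ, 0 < LΨ ∧ ∃ U ∈ 𝓝 (1 : Matrix (Fin d) (Fin d) ℝ), ∀ G ∈ U, ∀ G' ∈ U,
        ICL.frobNorm (Ψ G - Ψ G') ≤ LΨ * ICL.specNorm (G - G')) →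
      ∃ Δ : ℝ, 0 ≤ Δ ∧
        ∀ t : ℕ, d < t →
        ∃ E : Set (ICL.Context d t), MeasurableSet E ∧
          ENNReal.ofReal (1 - δ) ≤ ICL.contextLaw d t E ∧
          ∀ S ∈ E,
            ICL.frobNorm (Ψ (ICL.gram S) - Ψ 1) ≤ Δ ∧
            ∀ (Lσ : NNReal) (act : ℝ → ℝ), LipschitzWith Lσ act →
            ∀ (WV : Matrix (Fin dm) (Fin dm) ℝ) (Wc : Fin dm → ℝ) (Θ : Set (ICL.Param d dm))
              (γ γeff : ℝ), 0 < γ → γ + ICL.frobNorm (Ψ (ICL.gram S) - Ψ 1) ≤ γeff →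
            -- every parameter within `γ` of `W*` belongs to `Θ_{S_t}`
            ICL.restrictedParams Θ (Ψ 1) γ ⊆ ICL.restrictedParams Θ (Ψ (ICL.gram S)) γeff ∧
            ∀ LG : ℝ, 0 < LG →
            -- `G` is inverse Lipschitz on `Θ_{S_t}`
            (∀ θ₁ ∈ ICL.restrictedParams Θ (Ψ (ICL.gram S)) γeff,
              ∀ θ₂ ∈ ICL.restrictedParams Θ (Ψ (ICL.gram S)) γeff,
                ICL.paramDist θ₁ θ₂ ≤
                  LG * ‖ICL.effWeight act WV Wc S θ₁ - ICL.effWeight act WV Wc S θ₂‖) →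
            -- the effective weights lie in the tolerance ellipsoid
            ∀ r : ℝ, 0 < r → 2 * r ≤ t →
            ICL.effWeight act WV Wc S '' ICL.restrictedParams Θ (Ψ (ICL.gram S)) γeff ⊆
              ICL.toleranceEllipsoid S r →
            ∀ (m : ℕ), 0 < m → ∀ (Z : Fin m → ICL.Prompt d t) (Lf : ℝ), 0 ≤ Lf →
            -- `θ ↦ f_θ` is Lipschitz on `Θ_{S_t}` in the empirical norm
            (∀ θ₁ ∈ ICL.restrictedParams Θ (Ψ (ICL.gram S)) γeff,
              ∀ θ₂ ∈ ICL.restrictedParams Θ (Ψ (ICL.gram S)) γeff,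
                ICL.empNorm Z (ICL.transformer act WV Wc θ₁ - ICL.transformer act WV Wc θ₂) ≤
                  Lf * ICL.paramDist θ₁ θ₂) →
            (∀ s : Fin m → Bool, BddAbove (ICL.signedSums Z
              (ICL.functionClass t act WV Wc
                (ICL.restrictedParams Θ (Ψ (ICL.gram S)) γeff)) s)) ∧
            ICL.rademacher Z (ICL.functionClass t act WV Wc
                (ICL.restrictedParams Θ (Ψ (ICL.gram S)) γeff)) ≤
              C * LG * (Lf * √(r * ((d : ℝ) * dm + (dm : ℝ) ^ 2)) * √(Real.log (t / r)) /
                √((m : ℝ) * t)) := by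
  have hε : 0 < ENNReal.ofReal (δ / 2) := ENNReal.ofReal_pos.2 (half_pos hδ₀)
  obtain ⟨n, hn⟩ := ICL.exists_uniform_coercive d hε
  have hlog2 : 0 < Real.log 2 := Real.log_pos one_lt_two
  -- Chaining constant, times the radius factor from coercivity, over the lower bound for `√(log
  -- (t/r))`. Using `n + 1` keeps the constant and the radius positive even if `n = 0`.
  refine ⟨2 * (d + 2) * (14 * d + 2) * √(n + 1) / √(Real.log 2), by positivity, ?_⟩
  rintro dm hdm Ψ hΨ ⟨LΨ, -, U, hU, hlip⟩
  obtain ⟨N, hN⟩ := ICL.exists_uniform_attention_bound hΨ hU hlip hε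
  refine ⟨N, by positivity, fun t ht => ?_⟩
  have hmp := ICL.measurePreserving_inputs d t
  have hA := ICL.measurableSet_coercive (d := d) (t := t) n
  have hB : MeasurableSet {x : Fin t → ICL.Vec d | ICL.frobNorm (Ψ (ICL.inputGram x) - Ψ 1) ≤ N} :=
    measurableSet_le (ICL.measurable_frobNorm_sub_const hΨ _ t) measurable_const
  set E : Set (ICL.Context d t) := (fun S i => (S i).1) ⁻¹'
    ({x | ∀ v : ICL.Vec d, ‖v‖ ^ 2 ≤ n * ((t : ℝ)⁻¹ * ∑ i, inner ℝ v (x i) ^ 2)} ∩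
      {x | ICL.frobNorm (Ψ (ICL.inputGram x) - Ψ 1) ≤ N})
  have hE : MeasurableSet E := (hA.inter hB).preimage hmp.measurable
  refine ⟨E, hE, ?_, ?_⟩
  · have hcompl : ICL.contextLaw d t Eᶜ ≤ ENNReal.ofReal δ := by
      rw [← Set.preimage_compl, hmp.measure_preimage (hA.inter hB).compl.nullMeasurableSet,
        Set.compl_inter]
      refine (measure_union_le _ _).trans ((add_le_add (hn t ht) (hN t ht)).trans_eq ?_)
      rw [← ENNReal.ofReal_add (by positivity) (by positivity), add_halves]
    rw [ENNReal.ofReal_sub _ hδ₀.le, ENNReal.ofReal_one, ← compl_compl E,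
      prob_compl_eq_one_sub hE.compl]
    exact tsub_le_tsub_left hcompl 1
  rintro S ⟨hSA, hSB⟩
  refine ⟨by rw [ICL.gram_eq_inputGram]; exact hSB, ?_⟩
  intro Lσ act _ WV Wc Θ γ γeff _ hγeff
  refine ⟨ICL.restrictedParams_subset Θ _ _ hγeff, ?_⟩
  intro LG hLG hinv r hr hrt htol m hm Z Lf hLf hlipf
  have ht0 : (0 : ℝ) < t := by linarith
  have hm0 : (0 : ℝ) < m := by exact_mod_cast hm
  obtain ⟨hbdd, hrad⟩ := ICL.rademacher_functionClass_le hm act WV Wc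
    (ICL.restrictedParams Θ (Ψ (ICL.gram S)) γeff) Z (ICL.effWeight act WV Wc S)
    (WithLp.toLp 2 (ICL.ols S)) (R := √((n + 1) * (r / t))) (L := Lf * LG) (by positivity)
    (by positivity)
    (fun θ hθ => by
      have h := ICL.mem_toleranceEllipsoid_iff.1 (htol ⟨θ, hθ, rfl⟩)
      refine Real.le_sqrt_of_sq_le ((hSA _).trans ?_)
      calc (n : ℝ) * ((t : ℝ)⁻¹ * _) ≤ n * ((t : ℝ)⁻¹ * r) := by gcongr
        _ = n * (r / t) := by ring
        _ ≤ (n + 1) * (r / t) := by gcongr; linarith)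
    (fun θ₁ h₁ θ₂ h₂ => by
      rw [mul_assoc]
      exact (hlipf θ₁ h₁ θ₂ h₂).trans (mul_le_mul_of_nonneg_left (hinv θ₁ h₁ θ₂ h₂) hLf))
  refine ⟨hbdd, hrad.trans ?_⟩
  have hdm1 : (1 : ℝ) ≤ dm := by exact_mod_cast hdm
  have hD : (1 : ℝ) ≤ (d : ℝ) * dm + (dm : ℝ) ^ 2 := by
    have : (0 : ℝ) ≤ (d : ℝ) * dm := by positivity
    nlinarith
  have hlog : Real.log 2 ≤ Real.log (t / r) :=
    Real.log_le_log two_pos ((le_div_iff₀ hr).2 hrt)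
  -- The assumption `2 r ≤ t` keeps the logarithm at least `log 2`, so this factor can be inserted
  -- into the chaining bound.
  have hfac : 1 ≤ √(Real.log (t / r)) / √(Real.log 2) :=
    (one_le_div (by positivity)).2 (Real.sqrt_le_sqrt hlog)
  rw [Real.sqrt_mul (by positivity) (r / t), Real.sqrt_div hr.le, Real.sqrt_mul hr.le,
    Real.sqrt_mul hm0.le]
  calc 2 * ((d : ℝ) + 2) * (14 * d + 2) * (Lf * LG * (√(n + 1) * (√r / √t))) / √m
      = 2 * ((d : ℝ) + 2) * (14 * d + 2) * √(n + 1) * LG * Lf * √r / (√m * √t) * (1 * 1) := by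
        field_simp
    _ ≤ 2 * ((d : ℝ) + 2) * (14 * d + 2) * √(n + 1) * LG * Lf * √r / (√m * √t) *
        (√((d : ℝ) * dm + (dm : ℝ) ^ 2) * (√(Real.log (t / r)) / √(Real.log 2))) := by
        gcongr
        exact Real.one_le_sqrt.2 hD
    _ = _ := by ring
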